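/- Let $A$ be a real $L\times J$ matrix (the routing matrix of a network with $L$ links and $J$ routes), $F$ a real $J\times p$ matrix, $\beta\in\mathbb R^p$, $\gamma\in\mathbb R$, $\sigma>0$. Let the flow-level traffic $X(t)\in\mathbb R^J$ and the link-level traffic $Y(t)\in\mathbb R^L$, $t\in\mathbb Z$, be $$X(t)=F\beta+\sigma\,\mathrm{diag}(|F\beta|^{\gamma})Z(t),\qquad Y(t)=A X(t),$$ where $Z=\{Z(t)\}_{t\in\mathbb Z}$ is an $\mathbb R^J$-valued Gaussian process with $Z(t)\sim\mathcal N(0,I_J)$ for every $t$ (powers and absolute values of vectors are taken entrywise). Assume that $\{X(t)\}$ is a stationary process and that its temporal correlations are the same on all routes: $\mathrm{Corr}(X_j(t),X_j(t+i))=\rho(i)$ for all $1\le j\le J$, $t\in\mathbb Z$ and $i\ge1$. Let $\mathcal O\subset\{1,\dots,L\}$ be a non-empty set of observed links, and let $A_o$ and $Y_o(t)$ consist of the rows of $A$ and the entries of $Y(t)$ with index in $\mathcal O$. Fix $t_0\in\mathbb Z$ and, for the window of size $m$, put $$\overline Y_o=\frac1m\sum_{i=0}^{m-1}Y_o(t_0-i),\qquad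 \widehat\Sigma_{Y_o}=\frac1{m-1}\sum_{i=0}^{m-1}\big(Y_o(t_0-i)-\overline Y_o\big)\big(Y_o(t_0-i)-\overline Y_o\big)^t .$$ For $b\in\mathbb R^p$ let $\Sigma_{oo}(b)=A_o\,\mathrm{diag}(|Fb|^{2\gamma})A_o^t$ and $G(b)=\Sigma_{oo}(b)^{-1}$, and define the iterated generalized least squares estimates by $$\widehat\beta_1=[(A_oF)^tA_oF]^{-1}(A_oF)^t\,\overline Y_o,\qquad \widehat\beta_{k+1}=[(A_oF)^tG(\widehat\beta_k)A_oF]^{-1}(A_oF)^tG(\widehat\beta_k)\,\overline Y_o\quad(k\ge1).$$ For $k\ge1$ let $$\widehat\sigma^2=\frac{\mathrm{vec}(\widehat\Sigma_{Y_o})^t\,\mathrm{vec}(\Sigma_{oo}(\widehat\beta_k))}{\mathrm{vec}(\Sigma_{oo}(\widehat\beta_k))^t\,\mathrm{vec}(\Sigma_{oo}(\widehat\beta_k))}.$$ Suppose that $A_o$ has full row rank, that $A_oF$ has full column rank, that all entries of $F\beta$ are positive, and that $\rho(\tau)\to0$ as $\tau\to\infty$. Then, for every fixed $k\ge1$, almost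 surely, $\widehat\sigma^2$ is well defined for all sufficiently large $m$ (all the inverses above that enter it exist and its denominator is non-zero), and $\widehat\sigma^2\to\sigma^2$ as $m\to\infty$. -/

import Mathlib

open MeasureTheory ProbabilityTheory Filter Topology Matrix

noncomputable section

namespace NetworkTraffic

/-! ### The traffic model

The network has `L` links and `J` routes.  `A` is the `L × J` routing matrix, `F` is a known
`J × p` matrix, and `β`, `σ` are the unknown parameters. -/

/-- The flow-level traffic `X(t) = Fβ + σ diag(|Fβ|^γ) Z(t)` driven by the noise `Z`. -/
def flowTraffic {Ω : Type*} {J p : ℕ} (F : Matrix (Fin J) (Fin p) ℝ) (β : Fin p → ℝ) (γ σ : ℝ)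
    (Z : ℤ → Ω → Fin J → ℝ) (t : ℤ) (ω : Ω) : Fin J → ℝ :=
  F *ᵥ β + σ • (diagonal (fun j => |(F *ᵥ β) j| ^ γ) *ᵥ Z t ω)

/-- The link-level traffic `Y(t) = A X(t)` (routing equation). -/
def linkTraffic {Ω : Type*} {L J : ℕ} (A : Matrix (Fin L) (Fin J) ℝ)
    (X : ℤ → Ω → Fin J → ℝ) (t : ℤ) (ω : Ω) : Fin L → ℝ :=
  A *ᵥ X t ω

/-- The matrix `A_o` of the rows of the routing matrix that belong to the observed links. -/
def observedRouting {L J : ℕ} (A : Matrix (Fin L) (Fin J) ℝ) (O : Finset (Fin L)) :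
    Matrix O (Fin J) ℝ :=
  A.submatrix (fun l : O => (l : Fin L)) id

/-- The restriction `Y_o` of the link-level traffic to the observed links, along one sample
path `ω`. -/
def observedTraffic {Ω : Type*} {L : ℕ} (O : Finset (Fin L)) (Y : ℤ → Ω → Fin L → ℝ) (ω : Ω)
    (t : ℤ) : O → ℝ :=
  fun l => Y t ω l

/-- Strict stationarity of a (vector-valued) process indexed by `ℤ`: the law of the whole
trajectory is invariant under every time shift. -/
def IsStrictlyStationary {Ω E : Type*} [MeasurableSpace Ω] [MeasurableSpace E]
    (X : ℤ → Ω → E) (P : Measure Ω) : Prop :=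
  ∀ h : ℤ, IdentDistrib (fun ω (t : ℤ) => X (t + h) ω) (fun ω (t : ℤ) => X t ω) P P

/-- Correlation coefficient of two real random variables. -/
def corr {Ω : Type*} [MeasurableSpace Ω] (U V : Ω → ℝ) (P : Measure Ω) : ℝ :=
  cov[U, V; P] / (√(Var[U; P]) * √(Var[V; P]))

/-! ### The estimators

They are functions of the data `y : ℤ → o → ℝ` (the observed traffic, of which only the values
at the times `t₀ - m + 1, …, t₀` are used) and of the known `A_o`, `F`, `γ`. -/

variable {o : Type*} [Fintype o] [DecidableEq o] {J p : ℕ}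

/-- The mean `m⁻¹ ∑_{k=0}^{m-1} y(t₀ - k)` over the window of size `m` ending at `t₀`. -/
def windowMean (y : ℤ → o → ℝ) (t₀ : ℤ) (m : ℕ) : o → ℝ :=
  (m : ℝ)⁻¹ • ∑ k ∈ Finset.range m, y (t₀ - k)

/-- The sample covariance matrix over the window of size `m` ending at `t₀`. -/
def sampleCov (y : ℤ → o → ℝ) (t₀ : ℤ) (m : ℕ) : Matrix o o ℝ :=
  ((m : ℝ) - 1)⁻¹ • ∑ k ∈ Finset.range m,
    vecMulVec (y (t₀ - k) - windowMean y t₀ m) (y (t₀ - k) - windowMean y t₀ m)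

/-- `Σ_oo(b) = A_o diag(|Fb|^{2γ}) A_oᵗ`. -/
def sigmaOO (Ao : Matrix o (Fin J) ℝ) (F : Matrix (Fin J) (Fin p) ℝ) (γ : ℝ) (b : Fin p → ℝ) :
    Matrix o o ℝ :=
  Ao * diagonal (fun j => |(F *ᵥ b) j| ^ (2 * γ)) * Aoᵀ

/-- `G(b) = Σ_oo(b)⁻¹`. -/
def G (Ao : Matrix o (Fin J) ℝ) (F : Matrix (Fin J) (Fin p) ℝ) (γ : ℝ) (b : Fin p → ℝ) :
    Matrix o o ℝ :=
  (sigmaOO Ao F γ b)⁻¹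

/-- The ordinary least squares estimate `[(A_oF)ᵗ A_oF]⁻¹ (A_oF)ᵗ ȳ`. -/
def olsEstimate (Ao : Matrix o (Fin J) ℝ) (F : Matrix (Fin J) (Fin p) ℝ) (ybar : o → ℝ) :
    Fin p → ℝ :=
  (((Ao * F)ᵀ * (Ao * F))⁻¹ * (Ao * F)ᵀ) *ᵥ ybar

/-- One step of the iteration, `b ↦ [(A_oF)ᵗ G(b) A_oF]⁻¹ (A_oF)ᵗ G(b) ȳ`. -/
def glsStep (Ao : Matrix o (Fin J) ℝ) (F : Matrix (Fin J) (Fin p) ℝ) (γ : ℝ) (ybar : o → ℝ)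
    (b : Fin p → ℝ) : Fin p → ℝ :=
  (((Ao * F)ᵀ * G Ao F γ b * (Ao * F))⁻¹ * ((Ao * F)ᵀ * G Ao F γ b)) *ᵥ ybar

/-- The iterated GLS estimates `β̂_k`, `k ≥ 1`: `β̂_1` is the OLS estimate and `β̂_{k+1}` is obtained
from `β̂_k` by one step of the iteration.  (The value at `k = 0` is a dummy.) -/
def betaHat (Ao : Matrix o (Fin J) ℝ) (F : Matrix (Fin J) (Fin p) ℝ) (γ : ℝ) (ybar : o → ℝ) :
    ℕ → Fin p → ℝ
  | 0 => 0
  | 1 => olsEstimate Ao F ybar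
  | k + 2 => glsStep Ao F γ ybar (betaHat Ao F γ ybar (k + 1))

/-- The regression estimate
`vec(S)ᵗ vec(Σ_oo(b)) / vec(Σ_oo(b))ᵗ vec(Σ_oo(b))` of `σ²` from a covariance matrix `S`. -/
def sigmaSqEstimate (Ao : Matrix o (Fin J) ℝ) (F : Matrix (Fin J) (Fin p) ℝ) (γ : ℝ)
    (S : Matrix o o ℝ) (b : Fin p → ℝ) : ℝ :=
  (S.vec ⬝ᵥ (sigmaOO Ao F γ b).vec) / ((sigmaOO Ao F γ b).vec ⬝ᵥ (sigmaOO Ao F γ b).vec)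

/-- `σ̂²` computed from the window of size `m` ending at `t₀`, with `β̂ = β̂_k`. -/
def sigmaSqHat (Ao : Matrix o (Fin J) ℝ) (F : Matrix (Fin J) (Fin p) ℝ) (γ : ℝ) (k : ℕ)
    (y : ℤ → o → ℝ) (t₀ : ℤ) (m : ℕ) : ℝ :=
  sigmaSqEstimate Ao F γ (sampleCov y t₀ m) (betaHat Ao F γ (windowMean y t₀ m) k)

/-- `σ̂²` is well defined: the window has at least two observations, every inverse used in the
computation of `β̂_1, …, β̂_k` exists, and the denominator of the regression estimate is nonzero. -/
def SigmaSqHatWellDefined (Ao : Matrix o (Fin J) ℝ) (F : Matrix (Fin J) (Fin p) ℝ) (γ : ℝ) (k : ℕ)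
    (y : ℤ → o → ℝ) (t₀ : ℤ) (m : ℕ) : Prop :=
  2 ≤ m ∧
  IsUnit ((Ao * F)ᵀ * (Ao * F)) ∧
  (∀ i : ℕ, 1 ≤ i → i < k →
    IsUnit (sigmaOO Ao F γ (betaHat Ao F γ (windowMean y t₀ m) i)) ∧
    IsUnit ((Ao * F)ᵀ * G Ao F γ (betaHat Ao F γ (windowMean y t₀ m) i) * (Ao * F))) ∧
  (sigmaOO Ao F γ (betaHat Ao F γ (windowMean y t₀ m) k)).vec ⬝ᵥ
    (sigmaOO Ao F γ (betaHat Ao F γ (windowMean y t₀ m) k)).vec ≠ 0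

end NetworkTraffic

end

/-! The estimator is a function of the window mean and the sample covariance, continuous at the
limits `(Ao * F) *ᵥ β` and `σ ^ 2 • sigmaOO Ao F γ β`: there every matrix to be inverted is positive
definite, and `β` is reproduced by least squares and by each GLS step. It therefore suffices to
prove strong laws for the centred observations and for their pairwise products.

Stationarity makes the backward shift on path space measure preserving, but ergodicity is not given,
and the hypotheses control only the autocorrelations of the single routes. A Hilbert space fact
bridges the gap: if the inner products of `g` with `g ∘ T^[n]` tend to zero, then `g ∘ T^[n]` tends
weakly to zero. This kills the lagged correlations between different routes, and it forces `g` to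
have integral zero over every invariant set (`setIntegral_eq_zero_of_tendsto`), which with the
maximal ergodic inequality yields `ae_tendsto_birkhoffAverage_zero`.

For Gaussian variables the covariance of squares is twice the squared covariance, so the same
theorem applies to squares of linear combinations; polarization then gives the products. -/

/-- A bounded sequence in a Hilbert space whose inner products with each of its own terms tend to
zero converges weakly to zero. -/
theorem tendsto_inner_zero_of_tendsto_inner_self {H : Type*} [NormedAddCommGroup H]
    [InnerProductSpace ℝ H] [CompleteSpace H] {v : ℕ → H} {C : ℝ} (hC : ∀ n, ‖v n‖ ≤ C)
    (hv : ∀ m, Tendsto (fun n => inner ℝ (v m) (v n)) atTop (𝓝 0)) (y : H) :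
    Tendsto (fun n => inner ℝ y (v n)) atTop (𝓝 0) := by
  -- The claim holds on the span by linearity, on its closure by boundedness, and everywhere because
  -- the component of `y` orthogonal to `K` is orthogonal to every `v n`.
  let K : Submodule ℝ H := (Submodule.span ℝ (Set.range v)).topologicalClosure
  have hspan : ∀ z ∈ Submodule.span ℝ (Set.range v),
      Tendsto (fun n => inner ℝ z (v n)) atTop (𝓝 0) := by
    intro z hz
    induction hz using Submodule.span_induction with
    | mem x hx => obtain ⟨m, rfl⟩ := hx; exact hv m
    | zero => simp
    | add x y _ _ hx hy => simpa [inner_add_left] using hx.add hy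
    | smul a x _ hx => simpa [real_inner_smul_left] using hx.const_mul a
  have hclosed : ∀ z ∈ K, Tendsto (fun n => inner ℝ z (v n)) atTop (𝓝 0) := by
    intro z hz
    have hC0 : 0 ≤ C := (norm_nonneg _).trans (hC 0)
    rw [Metric.tendsto_atTop]
    intro ε hε
    -- `C + 1` rather than `C`, since `C` may be zero.
    obtain ⟨w, hw, hzw⟩ := Metric.mem_closure_iff.1 hz (ε / (2 * (C + 1))) (by positivity)
    obtain ⟨N, hN⟩ := Metric.tendsto_atTop.1 (hspan w hw) (ε / 2) (by positivity)
    refine ⟨N, fun n hn => ?_⟩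
    have h1 := hN n hn
    rw [Real.dist_eq, sub_zero] at h1 ⊢
    have h2 : inner ℝ z (v n) = inner ℝ (z - w) (v n) + inner ℝ w (v n) := by
      rw [← inner_add_left, sub_add_cancel]
    have h3 : |inner ℝ (z - w) (v n)| ≤ ε / (2 * (C + 1)) * C := by
      refine (abs_real_inner_le_norm _ _).trans ?_
      rw [dist_eq_norm] at hzw
      exact mul_le_mul hzw.le (hC n) (norm_nonneg _) (by positivity)
    have h4 : ε / (2 * (C + 1)) * C ≤ ε / 2 := by
      rw [div_mul_eq_mul_div, div_le_div_iff₀ (by positivity) (by positivity)]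
      nlinarith
    rw [h2]
    exact (abs_add_le _ _).trans_lt (by linarith)
  have hK : IsClosed (K : Set H) := Submodule.isClosed_topologicalClosure _
  have : CompleteSpace K := hK.completeSpace_coe
  have hdecomp : ∀ n, inner ℝ y (v n) = inner ℝ ((K.orthogonalProjectionOnto y : H)) (v n) := by
    intro n
    have hvn : v n ∈ K := Submodule.le_topologicalClosure _ (Submodule.subset_span ⟨n, rfl⟩)
    have h0 := Submodule.sub_starProjection_mem_orthogonal (K := K) y
    have h1 := (Submodule.mem_orthogonal' K _).1 h0 (v n) hvn
    rw [inner_sub_left, sub_eq_zero] at h1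
    exact h1
  simp_rw [hdecomp]
  exact hclosed _ (Submodule.coe_mem _)

/-! ### Pointwise ergodic theorem from decay of autocorrelations. -/

section Ergodic

variable {α : Type*} [MeasurableSpace α] {μ : Measure α} {T : α → α}

/-- Decay of the autocorrelations of `g` along a measure preserving map implies decay of its
correlations with every square integrable function. -/
theorem tendsto_integral_mul_comp_iterate (hT : MeasurePreserving T μ μ) {g φ : α → ℝ}
    (hg : MemLp g 2 μ) (hφ : MemLp φ 2 μ)
    (h : Tendsto (fun n => ∫ x, g x * g (T^[n] x) ∂μ) atTop (𝓝 0)) :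
    Tendsto (fun n => ∫ x, φ x * g (T^[n] x) ∂μ) atTop (𝓝 0) := by
  have hgn : ∀ n, MemLp (fun x => g (T^[n] x)) 2 μ := fun n =>
    hg.comp_measurePreserving (hT.iterate n)
  have hinner : ∀ {a b : α → ℝ} (ha : MemLp a 2 μ) (hb : MemLp b 2 μ),
      inner ℝ (ha.toLp a) (hb.toLp b) = ∫ x, a x * b x ∂μ := by
    intro a b ha hb
    rw [L2.inner_def]
    refine integral_congr_ae ?_
    filter_upwards [ha.coeFn_toLp, hb.coeFn_toLp] with x h1 h2
    rw [h1, h2]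
    simp [mul_comm]
  -- Invariance of the measure removes the common `T^[m]`, so the inner product of two terms depends
  -- only on the lag.
  have hint : ∀ m n, m ≤ n →
      ∫ x, g (T^[m] x) * g (T^[n] x) ∂μ = ∫ x, g x * g (T^[n - m] x) ∂μ := by
    intro m n hmn
    have hmp := hT.iterate m
    have hm : AEStronglyMeasurable (fun x => g x * g (T^[n - m] x)) (μ.map T^[m]) := by
      rw [hmp.map_eq]
      exact hg.1.mul (hgn _).1
    rw [← hmp.map_eq, integral_map hmp.measurable.aemeasurable hm, hmp.map_eq]
    refine integral_congr_ae (.of_forall fun x => ?_)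
    simp only [← Function.iterate_add_apply, Nat.sub_add_cancel hmn]
  have key := tendsto_inner_zero_of_tendsto_inner_self
    (v := fun n => (hgn n).toLp _) (C := ‖hg.toLp g‖) (fun n => ?_) (fun m => ?_) (hφ.toLp φ)
  · simpa only [hinner] using key
  · rw [Lp.norm_toLp, Lp.norm_toLp]
    exact (congrArg ENNReal.toReal
      (eLpNorm_comp_measurePreserving hg.1 (hT.iterate n))).le
  · simp only [hinner]
    have h1 := h.comp (tendsto_sub_atTop_nat m)
    refine h1.congr' ?_
    filter_upwards [eventually_ge_atTop m] with n hn
    exact (hint m n hn).symm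

/-- The running maxima `max (0, S₁h, …, Sₙh)` of the Birkhoff sums of `h`. -/
def birkhoffMax (T : α → α) (h : α → ℝ) : ℕ → α → ℝ
  | 0 => 0
  | n + 1 => fun x => max 0 (h x + birkhoffMax T h n (T x))

omit [MeasurableSpace α] in
theorem birkhoffMax_nonneg (T : α → α) (h : α → ℝ) (n : ℕ) (x : α) : 0 ≤ birkhoffMax T h n x := by
  cases n with
  | zero => exact le_rfl
  | succ n => exact le_max_left _ _

omit [MeasurableSpace α] in
theorem birkhoffMax_le_succ (T : α → α) (h : α → ℝ) (n : ℕ) (x : α) :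
    birkhoffMax T h n x ≤ birkhoffMax T h (n + 1) x := by
  induction n generalizing x with
  | zero => exact birkhoffMax_nonneg T h 1 x
  | succ n ih =>
    exact max_le_max le_rfl (add_le_add le_rfl (ih (T x)))

omit [MeasurableSpace α] in
theorem birkhoffSum_le_birkhoffMax (T : α → α) (h : α → ℝ) (n : ℕ) (x : α) :
    birkhoffSum T h n x ≤ birkhoffMax T h n x := by
  induction n generalizing x with
  | zero => simp [birkhoffMax]
  | succ n ih =>
    rw [birkhoffSum_succ']
    exact (add_le_add le_rfl (ih (T x))).trans (le_max_right _ _)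

theorem measurable_birkhoffMax (hT : Measurable T) {h : α → ℝ} (hh : Measurable h) (n : ℕ) :
    Measurable (birkhoffMax T h n) := by
  induction n with
  | zero => exact measurable_const
  | succ n ih => exact measurable_const.max (hh.add (ih.comp hT))

theorem integrable_birkhoffMax (hT : MeasurePreserving T μ μ) {h : α → ℝ} (hh : Integrable h μ)
    (n : ℕ) : Integrable (birkhoffMax T h n) μ := by
  induction n with
  | zero => exact integrable_zero _ _ _
  | succ n ih =>
    exact (integrable_zero _ _ _).sup (hh.add (hT.integrable_comp_of_integrable ih))

/-- The maximal ergodic inequality. -/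
theorem setIntegral_nonneg_of_birkhoffMax_pos (hT : MeasurePreserving T μ μ) {h : α → ℝ}
    (hm : Measurable h) (hh : Integrable h μ) (n : ℕ) :
    0 ≤ ∫ x in {x | 0 < birkhoffMax T h n x}, h x ∂μ := by
  set s := {x | 0 < birkhoffMax T h n x} with hs
  have hMm := measurable_birkhoffMax hT.measurable hm n
  have hsm : MeasurableSet s := measurableSet_lt measurable_const hMm
  have hM := integrable_birkhoffMax hT hh n
  have hMT : Integrable (fun x => birkhoffMax T h n (T x)) μ := hT.integrable_comp_of_integrable hM
  -- Garsia's argument: where the maximum `M n` is positive, so is `M (n + 1)`, hence `M (n + 1) = h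
  -- + M n ∘ T` and `M n - M n ∘ T ≤ h`. The left side has nonnegative integral over `s`, because `M
  -- n` vanishes off `s`, `M n ∘ T` is nonnegative, and both have the same total integral.
  have h1 : ∫ x in s, (birkhoffMax T h n x - birkhoffMax T h n (T x)) ∂μ ≤ ∫ x in s, h x ∂μ := by
    refine setIntegral_mono_on (hM.sub hMT).integrableOn hh.integrableOn hsm fun x hx => ?_
    have h2 := birkhoffMax_le_succ T h n x
    have h3 : 0 < birkhoffMax T h (n + 1) x := lt_of_lt_of_le hx h2
    have h4 : birkhoffMax T h (n + 1) x = h x + birkhoffMax T h n (T x) := by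
      rcases le_total 0 (h x + birkhoffMax T h n (T x)) with h5 | h5
      · exact max_eq_right h5
      · have : birkhoffMax T h (n + 1) x = 0 := max_eq_left h5
        linarith
    linarith
  rw [integral_sub hM.integrableOn hMT.integrableOn] at h1
  have h5 : ∫ x in s, birkhoffMax T h n x ∂μ = ∫ x, birkhoffMax T h n x ∂μ := by
    refine setIntegral_eq_integral_of_forall_compl_eq_zero fun x hx => ?_
    exact le_antisymm (not_lt.1 hx) (birkhoffMax_nonneg T h n x)
  have h6 : ∫ x in s, birkhoffMax T h n (T x) ∂μ ≤ ∫ x, birkhoffMax T h n (T x) ∂μ :=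
    setIntegral_le_integral hMT (.of_forall fun x => birkhoffMax_nonneg T h n (T x))
  have h7 : ∫ x, birkhoffMax T h n (T x) ∂μ = ∫ x, birkhoffMax T h n x ∂μ := by
    have := integral_map (f := birkhoffMax T h n) hT.measurable.aemeasurable
      hMm.aestronglyMeasurable (μ := μ)
    rw [hT.map_eq] at this
    exact this.symm
  linarith

/-- The sets where the running maxima are positive increase to a set of full measure, so the maximal
inequality passes to the limit. -/
theorem integral_nonneg_of_exists_birkhoffSum_pos (hT : MeasurePreserving T μ μ) {h : α → ℝ}
    (hm : Measurable h) (hh : Integrable h μ) (hpos : ∀ᵐ x ∂μ, ∃ n, 0 < birkhoffSum T h n x) :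
    0 ≤ ∫ x, h x ∂μ := by
  have hlim := tendsto_setIntegral_of_monotone (μ := μ) (f := h)
    (s := fun n => {x | 0 < birkhoffMax T h n x})
    (fun n => measurableSet_lt measurable_const (measurable_birkhoffMax hT.measurable hm n))
    (monotone_nat_of_le_succ fun n x hx => lt_of_lt_of_le hx (birkhoffMax_le_succ T h n x))
    hh.integrableOn
  have huniv : (⋃ n, {x | 0 < birkhoffMax T h n x}) =ᵐ[μ] (Set.univ : Set α) := by
    rw [eventuallyEq_univ]
    filter_upwards [hpos] with x ⟨n, hn⟩
    exact Set.mem_iUnion.2 ⟨n, hn.trans_le (birkhoffSum_le_birkhoffMax T h n x)⟩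
  rw [setIntegral_congr_set huniv, setIntegral_univ] at hlim
  exact ge_of_tendsto' hlim fun n => setIntegral_nonneg_of_birkhoffMax_pos hT hm hh n

/-- The points at which the Birkhoff sums of `h` are unbounded above. -/
def birkhoffUnbdd (T : α → α) (h : α → ℝ) : Set α :=
  {x | ∀ K : ℕ, ∃ n, (K : ℝ) < birkhoffSum T h n x}

theorem measurable_birkhoffSum (hT : Measurable T) {h : α → ℝ} (hh : Measurable h) (n : ℕ) :
    Measurable (birkhoffSum T h n) :=
  Finset.measurable_fun_sum _ fun i _ => hh.comp (hT.iterate i)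

theorem measurableSet_birkhoffUnbdd (hT : Measurable T) {h : α → ℝ} (hh : Measurable h) :
    MeasurableSet (birkhoffUnbdd T h) := by
  have : birkhoffUnbdd T h = ⋂ K : ℕ, ⋃ n, {x | (K : ℝ) < birkhoffSum T h n x} := by
    ext x; simp [birkhoffUnbdd]
  rw [this]
  exact .iInter fun K => .iUnion fun n =>
    measurableSet_lt measurable_const (measurable_birkhoffSum hT hh n)

-- Birkhoff sums at `x` and at `T x` differ by the single term `h x`, which cannot affect
-- unboundedness. This exact invariance is the reason for working with unbounded sums rather than
-- with sums that are positive for some `n`.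
omit [MeasurableSpace α] in
theorem preimage_birkhoffUnbdd (T : α → α) (h : α → ℝ) :
    T ⁻¹' birkhoffUnbdd T h = birkhoffUnbdd T h := by
  ext x
  simp only [Set.mem_preimage, birkhoffUnbdd, Set.mem_ofPred_eq]
  obtain ⟨R, hR⟩ := exists_nat_ge |h x|
  have hR1 := (abs_le.1 hR).1
  have hR2 := (abs_le.1 hR).2
  constructor
  · intro H K
    obtain ⟨n, hn⟩ := H (K + R)
    refine ⟨n + 1, ?_⟩
    rw [birkhoffSum_succ']
    push_cast at hn
    linarith
  · intro H K
    obtain ⟨n, hn⟩ := H (K + R)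
    cases n with
    | zero =>
      rw [birkhoffSum_zero] at hn
      exact absurd hn (not_lt.2 (Nat.cast_nonneg _))
    | succ n =>
      refine ⟨n, ?_⟩
      rw [birkhoffSum_succ'] at hn
      push_cast at hn
      linarith

omit [MeasurableSpace α] in
theorem preimage_iterate_of_preimage {s : Set α} (hs : T ⁻¹' s = s) (n : ℕ) : T^[n] ⁻¹' s = s := by
  induction n with
  | zero => rfl
  | succ n ih => rw [Function.iterate_succ', Set.preimage_comp, hs, ih]

/-- Invariance of the set lets `T` preserve the restricted measure, under which almost every point
has a positive Birkhoff sum. -/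
theorem setIntegral_nonneg_birkhoffUnbdd (hT : MeasurePreserving T μ μ) {h : α → ℝ}
    (hm : Measurable h) (hh : Integrable h μ) : 0 ≤ ∫ x in birkhoffUnbdd T h, h x ∂μ := by
  have hE := measurableSet_birkhoffUnbdd hT.measurable hm
  have hTE := hT.restrict_preimage hE
  rw [preimage_birkhoffUnbdd] at hTE
  refine integral_nonneg_of_exists_birkhoffSum_pos hTE hm hh.integrableOn ?_
  filter_upwards [ae_restrict_mem hE] with x hx
  simpa using hx 0

/-- Substitute for ergodicity: the integral of `g ∘ T^[n]` over an invariant set does not depend on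
`n`, yet it is the correlation of `g ∘ T^[n]` with an indicator, which tends to zero. -/
theorem setIntegral_eq_zero_of_tendsto [IsFiniteMeasure μ] (hT : MeasurePreserving T μ μ)
    {g : α → ℝ} (hg : MemLp g 2 μ)
    (h : Tendsto (fun n => ∫ x, g x * g (T^[n] x) ∂μ) atTop (𝓝 0)) {E : Set α}
    (hE : MeasurableSet E) (hTE : T ⁻¹' E = E) : ∫ x in E, g x ∂μ = 0 := by
  have hφ : MemLp (E.indicator fun _ => (1 : ℝ)) 2 μ := (memLp_const 1).indicator hE
  have hlim := tendsto_integral_mul_comp_iterate hT hg hφ h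
  refine tendsto_nhds_unique ((tendsto_congr fun n => ?_).1 tendsto_const_nhds) hlim
  have hn := (hT.iterate n).restrict_preimage hE
  rw [preimage_iterate_of_preimage hTE] at hn
  have hgm : AEStronglyMeasurable g ((μ.restrict E).map T^[n]) := by
    rw [hn.map_eq]; exact hg.1.restrict
  calc ∫ x in E, g x ∂μ = ∫ x in E, g (T^[n] x) ∂μ := by
        rw [← integral_map hn.measurable.aemeasurable hgm, hn.map_eq]
    _ = ∫ x, E.indicator (fun _ => (1 : ℝ)) x * g (T^[n] x) ∂μ := by
        rw [← integral_indicator hE]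
        congr 1
        ext x
        by_cases hx : x ∈ E <;> simp [hx]

/-- On the set `U` where the sums of `g - ε` are unbounded, `0 ≤ ∫ (g - ε) = -ε μ(U)`, so `U` is
null. Off `U` those sums are at most some `K`, and the average of `g` is at most `ε + K / n`. -/
theorem ae_eventually_birkhoffAverage_le [IsFiniteMeasure μ] (hT : MeasurePreserving T μ μ)
    {g : α → ℝ} (hgm : Measurable g) (hg : MemLp g 2 μ)
    (h : Tendsto (fun n => ∫ x, g x * g (T^[n] x) ∂μ) atTop (𝓝 0)) {ε : ℝ} (hε : 0 < ε) :
    ∀ᵐ x ∂μ, ∀ᶠ n in atTop, birkhoffAverage ℝ T g n x ≤ 2 * ε := by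
  have hgi : Integrable g μ := hg.integrable one_le_two
  set f : α → ℝ := fun x => g x - ε with hf
  have hfm : Measurable f := hgm.sub_const ε
  have hE := measurableSet_birkhoffUnbdd hT.measurable hfm
  have h1 := setIntegral_nonneg_birkhoffUnbdd hT hfm (hgi.sub (integrable_const ε))
  rw [hf, integral_sub hgi.integrableOn (integrable_const ε), ← hf,
    setIntegral_eq_zero_of_tendsto hT hg h hE (preimage_birkhoffUnbdd T f), setIntegral_const,
    smul_eq_mul] at h1
  have h2 : μ.real (birkhoffUnbdd T f) = 0 := by
    nlinarith [measureReal_nonneg (μ := μ) (s := birkhoffUnbdd T f)]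
  have h3 : μ (birkhoffUnbdd T f) = 0 := (measureReal_eq_zero_iff).1 h2
  filter_upwards [measure_eq_zero_iff_ae_notMem.1 h3] with x hx
  simp only [birkhoffUnbdd, Set.mem_ofPred_eq, not_forall, not_exists, not_lt] at hx
  obtain ⟨K, hK⟩ := hx
  obtain ⟨N, hN⟩ := exists_nat_ge (K / ε)
  filter_upwards [eventually_ge_atTop (max N 1)] with n hn
  have hn1 : (1 : ℝ) ≤ n := by exact_mod_cast (le_max_right _ _).trans hn
  have hnN : (N : ℝ) ≤ n := by exact_mod_cast (le_max_left _ _).trans hn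
  have hS : birkhoffSum T f n x = birkhoffSum T g n x - n * ε := by
    simp [birkhoffSum, hf, Finset.sum_sub_distrib]
  have h4 := hK n
  rw [hS] at h4
  have h5 : (K : ℝ) ≤ n * ε := by
    rw [← div_le_iff₀ hε]; linarith
  rw [birkhoffAverage, smul_eq_mul, inv_mul_le_iff₀ (by linarith)]
  linarith

/-- Pointwise ergodic theorem for square integrable functions with vanishing autocorrelations. -/
theorem ae_tendsto_birkhoffAverage_zero [IsFiniteMeasure μ] (hT : MeasurePreserving T μ μ)
    {g : α → ℝ} (hgm : Measurable g) (hg : MemLp g 2 μ)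
    (h : Tendsto (fun n => ∫ x, g x * g (T^[n] x) ∂μ) atTop (𝓝 0)) :
    ∀ᵐ x ∂μ, Tendsto (fun n => birkhoffAverage ℝ T g n x) atTop (𝓝 0) := by
  have hpos : ∀ q : ℕ, (0 : ℝ) < 1 / (q + 1) := fun q => Nat.one_div_pos_of_nat
  have h1 : ∀ᵐ x ∂μ, ∀ q : ℕ, ∀ᶠ n in atTop,
      birkhoffAverage ℝ T g n x ≤ 2 * (1 / (q + 1)) :=
    ae_all_iff.2 fun q => ae_eventually_birkhoffAverage_le hT hgm hg h (hpos q)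
  have h2 : ∀ᵐ x ∂μ, ∀ q : ℕ, ∀ᶠ n in atTop,
      birkhoffAverage ℝ T (-g) n x ≤ 2 * (1 / (q + 1)) :=
    ae_all_iff.2 fun q => ae_eventually_birkhoffAverage_le hT hgm.neg hg.neg
      (by simpa using h) (hpos q)
  filter_upwards [h1, h2] with x hx1 hx2
  rw [Metric.tendsto_nhds]
  intro ε hε
  obtain ⟨q, hq⟩ := exists_nat_one_div_lt (show 0 < ε / 2 by positivity)
  filter_upwards [hx1 q, hx2 q] with n hn1 hn2
  rw [birkhoffAverage_neg, Pi.neg_apply, Pi.neg_apply] at hn2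
  rw [Real.dist_eq, sub_zero, abs_lt]
  constructor <;> linarith

end Ergodic

/-! ### Continuity and consistency of the estimators along a fixed data sequence. -/

section Deterministic

theorem Filter.Tendsto.matrixMul {ι m n k : Type*} [Fintype n] {l : Filter ι}
    {a : ι → Matrix m n ℝ} {b : ι → Matrix n k ℝ} {A : Matrix m n ℝ} {B : Matrix n k ℝ}
    (ha : Tendsto a l (𝓝 A)) (hb : Tendsto b l (𝓝 B)) :
    Tendsto (fun i => a i * b i) l (𝓝 (A * B)) :=
  ((continuous_fst.matrix_mul continuous_snd).tendsto (A, B)).comp (ha.prodMk_nhds hb)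

theorem Filter.Tendsto.matrixMulVec {ι m n : Type*} [Fintype n] {l : Filter ι}
    {a : ι → Matrix m n ℝ} {b : ι → n → ℝ} {A : Matrix m n ℝ} {B : n → ℝ}
    (ha : Tendsto a l (𝓝 A)) (hb : Tendsto b l (𝓝 B)) :
    Tendsto (fun i => a i *ᵥ b i) l (𝓝 (A *ᵥ B)) :=
  ((continuous_fst.matrix_mulVec continuous_snd).tendsto (A, B)).comp (ha.prodMk_nhds hb)

theorem Filter.Tendsto.matrixInv {ι n : Type*} [Fintype n] [DecidableEq n] {l : Filter ι}
    {a : ι → Matrix n n ℝ} {A : Matrix n n ℝ} (ha : Tendsto a l (𝓝 A)) (hA : IsUnit A) :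
    Tendsto (fun i => (a i)⁻¹) l (𝓝 A⁻¹) := by
  have hdet : A.det ≠ 0 := ((isUnit_iff_isUnit_det A).1 hA).ne_zero
  refine (continuousAt_matrix_inv A ?_).tendsto.comp ha
  simpa only [Ring.inverse_eq_inv'] using continuousAt_inv₀ hdet

theorem Filter.Tendsto.eventually_isUnit_matrix {ι n : Type*} [Fintype n] [DecidableEq n]
    {l : Filter ι} {a : ι → Matrix n n ℝ} {A : Matrix n n ℝ} (ha : Tendsto a l (𝓝 A))
    (hA : IsUnit A) : ∀ᶠ i in l, IsUnit (a i) := by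
  have hdet : A.det ≠ 0 := ((isUnit_iff_isUnit_det A).1 hA).ne_zero
  have h : Tendsto (fun i => (a i).det) l (𝓝 A.det) :=
    ((continuous_id.matrix_det).tendsto A).comp ha
  filter_upwards [h.eventually_ne hdet] with i hi
  exact (isUnit_iff_isUnit_det _).2 hi.isUnit

theorem Matrix.mulVec_injective_of_rank {m n : Type*} [Finite m] [Fintype n] {A : Matrix m n ℝ}
    (h : A.rank = Fintype.card n) : Function.Injective A.mulVec := by
  rw [mulVec_injective_iff, linearIndependent_iff_card_eq_finrank_span, ← h,
    rank_eq_finrank_span_cols]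
  rfl

namespace NetworkTraffic

variable {o : Type*} [Fintype o] [DecidableEq o] {J p : ℕ}
  {Ao : Matrix o (Fin J) ℝ} {F : Matrix (Fin J) (Fin p) ℝ} {γ : ℝ} {β : Fin p → ℝ}

omit [DecidableEq o] in
theorem posDef_sigmaOO (hAo : Function.Injective Aoᵀ.mulVec) (hFβ : ∀ j, 0 < (F *ᵥ β) j) :
    (sigmaOO Ao F γ β).PosDef := by
  have h := (PosDef.diagonal (d := fun j => |(F *ᵥ β) j| ^ (2 * γ)) fun j =>
    Real.rpow_pos_of_pos (abs_pos.2 (hFβ j).ne') _).conjTranspose_mul_mul_same hAo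
  rwa [conjTranspose_eq_transpose_of_trivial, transpose_transpose] at h

-- Positivity of `F *ᵥ β` matters here: for negative `γ` the power is discontinuous at zero.
omit [Fintype o] [DecidableEq o] in
theorem tendsto_sigmaOO {ι : Type*} {l : Filter ι} (hFβ : ∀ j, 0 < (F *ᵥ β) j)
    {b : ι → Fin p → ℝ} (hb : Tendsto b l (𝓝 β)) :
    Tendsto (fun i => sigmaOO Ao F γ (b i)) l (𝓝 (sigmaOO Ao F γ β)) := by
  have hFb : Tendsto (fun i => F *ᵥ b i) l (𝓝 (F *ᵥ β)) := tendsto_const_nhds.matrixMulVec hb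
  have hd : Tendsto (fun i => fun j => |(F *ᵥ b i) j| ^ (2 * γ)) l
      (𝓝 fun j => |(F *ᵥ β) j| ^ (2 * γ)) := by
    refine tendsto_pi_nhds.2 fun j => ?_
    exact ((tendsto_pi_nhds.1 hFb j).abs).rpow_const (.inl (abs_pos.2 (hFβ j).ne').ne')
  have hD := ((continuous_id.matrix_diagonal).tendsto _).comp hd
  exact (tendsto_const_nhds.matrixMul hD).matrixMul tendsto_const_nhds

theorem isUnit_gram (hAoF : Function.Injective (Ao * F).mulVec) :
    IsUnit ((Ao * F)ᵀ * (Ao * F)) := by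
  have h := (PosDef.one (n := o) (R := ℝ)).conjTranspose_mul_mul_same hAoF
  rw [Matrix.mul_one, conjTranspose_eq_transpose_of_trivial] at h
  exact h.isUnit

theorem isUnit_weighted_gram (hAo : Function.Injective Aoᵀ.mulVec)
    (hAoF : Function.Injective (Ao * F).mulVec) (hFβ : ∀ j, 0 < (F *ᵥ β) j) :
    IsUnit ((Ao * F)ᵀ * G Ao F γ β * (Ao * F)) := by
  have h := (posDef_sigmaOO (γ := γ) hAo hFβ).inv.conjTranspose_mul_mul_same hAoF
  rw [conjTranspose_eq_transpose_of_trivial] at h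
  exact h.isUnit

theorem olsEstimate_mulVec (hAoF : Function.Injective (Ao * F).mulVec) :
    olsEstimate Ao F ((Ao * F) *ᵥ β) = β := by
  rw [olsEstimate, mulVec_mulVec, Matrix.mul_assoc,
    nonsing_inv_mul _ ((isUnit_iff_isUnit_det _).1 (isUnit_gram hAoF)), one_mulVec]

/-- At the exact mean the inverse cancels its own weighted Gram matrix, so `β` is a fixed point and
consistency propagates through the iteration. -/
theorem glsStep_mulVec (hAo : Function.Injective Aoᵀ.mulVec)
    (hAoF : Function.Injective (Ao * F).mulVec) (hFβ : ∀ j, 0 < (F *ᵥ β) j) :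
    glsStep Ao F γ ((Ao * F) *ᵥ β) β = β := by
  rw [glsStep, mulVec_mulVec, Matrix.mul_assoc, nonsing_inv_mul _
    ((isUnit_iff_isUnit_det _).1 (isUnit_weighted_gram hAo hAoF hFβ)), one_mulVec]

theorem tendsto_G {ι : Type*} {l : Filter ι} (hAo : Function.Injective Aoᵀ.mulVec)
    (hFβ : ∀ j, 0 < (F *ᵥ β) j) {b : ι → Fin p → ℝ} (hb : Tendsto b l (𝓝 β)) :
    Tendsto (fun i => G Ao F γ (b i)) l (𝓝 (G Ao F γ β)) :=
  (tendsto_sigmaOO hFβ hb).matrixInv (posDef_sigmaOO hAo hFβ).isUnit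

theorem tendsto_weighted_gram {ι : Type*} {l : Filter ι} (hAo : Function.Injective Aoᵀ.mulVec)
    (hFβ : ∀ j, 0 < (F *ᵥ β) j) {b : ι → Fin p → ℝ} (hb : Tendsto b l (𝓝 β)) :
    Tendsto (fun i => (Ao * F)ᵀ * G Ao F γ (b i) * (Ao * F)) l
      (𝓝 ((Ao * F)ᵀ * G Ao F γ β * (Ao * F))) :=
  (tendsto_const_nhds.matrixMul (tendsto_G hAo hFβ hb)).matrixMul tendsto_const_nhds

/-- Consistency of the iterated GLS estimates along a consistent sequence of means. -/
theorem tendsto_betaHat {ι : Type*} {l : Filter ι} (hAo : Function.Injective Aoᵀ.mulVec)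
    (hAoF : Function.Injective (Ao * F).mulVec) (hFβ : ∀ j, 0 < (F *ᵥ β) j)
    {ybar : ι → o → ℝ} (hy : Tendsto ybar l (𝓝 ((Ao * F) *ᵥ β))) (k : ℕ) :
    Tendsto (fun i => betaHat Ao F γ (ybar i) (k + 1)) l (𝓝 β) := by
  induction k with
  | zero =>
    have h : Tendsto (fun i => olsEstimate Ao F (ybar i)) l
        (𝓝 (olsEstimate Ao F ((Ao * F) *ᵥ β))) := tendsto_const_nhds.matrixMulVec hy
    rwa [olsEstimate_mulVec hAoF] at h
  | succ k ih =>
    have h : Tendsto (fun i => glsStep Ao F γ (ybar i) (betaHat Ao F γ (ybar i) (k + 1))) l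
        (𝓝 (glsStep Ao F γ ((Ao * F) *ᵥ β) β)) :=
      (((tendsto_weighted_gram hAo hFβ ih).matrixInv
        (isUnit_weighted_gram hAo hAoF hFβ)).matrixMul
        (tendsto_const_nhds.matrixMul (tendsto_G hAo hFβ ih))).matrixMulVec hy
    rwa [glsStep_mulVec hAo hAoF hFβ] at h

theorem tendsto_vec_dotProduct_vec {ι m n : Type*} [Fintype m] [Fintype n] {l : Filter ι}
    {a b : ι → Matrix m n ℝ} {A B : Matrix m n ℝ}
    (ha : Tendsto a l (𝓝 A)) (hb : Tendsto b l (𝓝 B)) :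
    Tendsto (fun i => (a i).vec ⬝ᵥ (b i).vec) l (𝓝 (A.vec ⬝ᵥ B.vec)) := by
  refine tendsto_finsetSum _ fun q _ => ?_
  exact (tendsto_pi_nhds.1 (tendsto_pi_nhds.1 ha q.2) q.1).mul
    (tendsto_pi_nhds.1 (tendsto_pi_nhds.1 hb q.2) q.1)

theorem vec_sigmaOO_dotProduct_ne_zero [Nonempty o] (hAo : Function.Injective Aoᵀ.mulVec)
    (hFβ : ∀ j, 0 < (F *ᵥ β) j) :
    (sigmaOO Ao F γ β).vec ⬝ᵥ (sigmaOO Ao F γ β).vec ≠ 0 := by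
  rw [Ne, dotProduct_self_eq_zero, vec_eq_zero_iff]
  intro h
  have h1 := (posDef_sigmaOO (γ := γ) hAo hFβ).isUnit
  rw [h] at h1
  -- This uses that `o` is nonempty: the empty zero matrix is a unit.
  exact not_isUnit_zero h1

/-- Consistency of the regression estimate of `σ²` along a data sequence whose window means and
sample covariances are consistent. -/
theorem sigmaSqHat_consistent [Nonempty o] (hAo : Function.Injective Aoᵀ.mulVec)
    (hAoF : Function.Injective (Ao * F).mulVec) (hFβ : ∀ j, 0 < (F *ᵥ β) j) {s : ℝ}
    {y : ℤ → o → ℝ} {t₀ : ℤ} (hmean : Tendsto (windowMean y t₀) atTop (𝓝 ((Ao * F) *ᵥ β)))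
    (hcov : Tendsto (sampleCov y t₀) atTop (𝓝 (s • sigmaOO Ao F γ β))) {k : ℕ} (hk : 1 ≤ k) :
    (∀ᶠ m : ℕ in atTop, SigmaSqHatWellDefined Ao F γ k y t₀ m) ∧
      Tendsto (sigmaSqHat Ao F γ k y t₀) atTop (𝓝 s) := by
  have hβ : ∀ i, 1 ≤ i →
      Tendsto (fun m => betaHat Ao F γ (windowMean y t₀ m) i) atTop (𝓝 β) := by
    intro i hi
    obtain ⟨i, rfl⟩ := Nat.exists_eq_add_of_le' hi
    exact tendsto_betaHat hAo hAoF hFβ hmean i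
  have hS := tendsto_sigmaOO (Ao := Ao) (γ := γ) hFβ (hβ k hk)
  have hden := tendsto_vec_dotProduct_vec hS hS
  have hne := vec_sigmaOO_dotProduct_ne_zero (γ := γ) hAo hFβ
  constructor
  · have hinv : ∀ᶠ m in atTop, ∀ i ∈ Finset.Ico 1 k,
        IsUnit (sigmaOO Ao F γ (betaHat Ao F γ (windowMean y t₀ m) i)) ∧
        IsUnit ((Ao * F)ᵀ * G Ao F γ (betaHat Ao F γ (windowMean y t₀ m) i) * (Ao * F)) := by
      rw [Finset.eventually_all]
      intro i hi
      have hi := hβ i (Finset.mem_Ico.1 hi).1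
      exact ((tendsto_sigmaOO hFβ hi).eventually_isUnit_matrix
        (posDef_sigmaOO hAo hFβ).isUnit).and
        ((tendsto_weighted_gram hAo hFβ hi).eventually_isUnit_matrix
          (isUnit_weighted_gram hAo hAoF hFβ))
    filter_upwards [eventually_ge_atTop 2, hinv, hden.eventually_ne hne] with m h1 h2 h3
    exact ⟨h1, isUnit_gram hAoF, fun i hi hik => h2 i (Finset.mem_Ico.2 ⟨hi, hik⟩), h3⟩
  · have h := (tendsto_vec_dotProduct_vec hcov hS).div hden hne
    rwa [vec_smul, smul_dotProduct, smul_eq_mul, mul_div_cancel_right₀ _ hne] at h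

omit [Fintype o] [DecidableEq o] in
/-- The window mean converges if the deviations from `a` average out. -/
theorem tendsto_windowMean {y : ℤ → o → ℝ} {t₀ : ℤ} {a : o → ℝ}
    (h : ∀ l, Tendsto (fun m : ℕ => (m : ℝ)⁻¹ * ∑ k ∈ Finset.range m, (y (t₀ - k) l - a l))
      atTop (𝓝 0)) :
    Tendsto (windowMean y t₀) atTop (𝓝 a) := by
  refine tendsto_pi_nhds.2 fun l => ?_
  have h1 := (h l).add_const (a l)
  rw [zero_add] at h1
  refine h1.congr' ?_
  filter_upwards [eventually_ne_atTop 0] with m hm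
  have hm' : (m : ℝ) ≠ 0 := by exact_mod_cast hm
  simp only [windowMean, Pi.smul_apply, Finset.sum_apply, smul_eq_mul, Finset.sum_sub_distrib,
    Finset.sum_const, Finset.card_range, nsmul_eq_mul]
  field_simp
  ring

omit [Fintype o] [DecidableEq o] in
/-- The sample covariance matrix converges if the averages of the products of the deviations
from `a` do. -/
theorem tendsto_sampleCov {y : ℤ → o → ℝ} {t₀ : ℤ} {a : o → ℝ} {C : Matrix o o ℝ}
    (h : ∀ l, Tendsto (fun m : ℕ => (m : ℝ)⁻¹ * ∑ k ∈ Finset.range m, (y (t₀ - k) l - a l))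
      atTop (𝓝 0))
    (h2 : ∀ l l', Tendsto (fun m : ℕ => (m : ℝ)⁻¹ *
      ∑ k ∈ Finset.range m, (y (t₀ - k) l - a l) * (y (t₀ - k) l' - a l')) atTop (𝓝 (C l l'))) :
    Tendsto (sampleCov y t₀) atTop (𝓝 C) := by
  refine tendsto_pi_nhds.2 fun l => tendsto_pi_nhds.2 fun l' => ?_
  -- The factor `m / (m - 1)` from the normalization of the sample covariance.
  have hratio : Tendsto (fun m : ℕ => (1 - (m : ℝ)⁻¹)⁻¹) atTop (𝓝 1) := by
    have h3 := (tendsto_inv_atTop_nhds_zero_nat (𝕜 := ℝ)).const_sub 1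
    rw [sub_zero] at h3
    simpa using h3.inv₀ one_ne_zero
  have h4 := hratio.mul ((h2 l l').sub ((h l).mul (h l')))
  rw [mul_zero, sub_zero, one_mul] at h4
  refine h4.congr' ?_
  filter_upwards [eventually_ge_atTop 2] with m hm
  have hm1 : (m : ℝ) ≠ 0 := by positivity
  have hm2 : (m : ℝ) - 1 ≠ 0 := by
    have : (2 : ℝ) ≤ m := by exact_mod_cast hm
    linarith
  have hmean : ∀ l, windowMean y t₀ m l
      = a l + (m : ℝ)⁻¹ * ∑ k ∈ Finset.range m, (y (t₀ - k) l - a l) := by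
    intro l
    simp only [windowMean, Pi.smul_apply, Finset.sum_apply, smul_eq_mul, Finset.sum_sub_distrib,
      Finset.sum_const, Finset.card_range, nsmul_eq_mul]
    field_simp
    ring
  have hsum : ∑ k ∈ Finset.range m,
      (y (t₀ - k) l - windowMean y t₀ m l) * (y (t₀ - k) l' - windowMean y t₀ m l')
      = ∑ k ∈ Finset.range m, (y (t₀ - k) l - a l) * (y (t₀ - k) l' - a l')
        - (m : ℝ)⁻¹ * (∑ k ∈ Finset.range m, (y (t₀ - k) l - a l))
          * (∑ k ∈ Finset.range m, (y (t₀ - k) l' - a l')) := by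
    rw [hmean l, hmean l']
    generalize hu : ∑ k ∈ Finset.range m, (y (t₀ - k) l - a l) = U
    generalize hv : ∑ k ∈ Finset.range m, (y (t₀ - k) l' - a l') = V
    have : ∀ k : ℕ, (y (t₀ - k) l - (a l + (m : ℝ)⁻¹ * U)) * (y (t₀ - k) l' - (a l' + (m : ℝ)⁻¹ * V))
        = (y (t₀ - k) l - a l) * (y (t₀ - k) l' - a l')
          - (m : ℝ)⁻¹ * V * (y (t₀ - k) l - a l) - (m : ℝ)⁻¹ * U * (y (t₀ - k) l' - a l')
          + (m : ℝ)⁻¹ * U * ((m : ℝ)⁻¹ * V) := fun k => by ring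
    simp_rw [this]
    rw [Finset.sum_add_distrib, Finset.sum_sub_distrib, Finset.sum_sub_distrib,
      ← Finset.mul_sum, ← Finset.mul_sum, hu, hv]
    simp only [Finset.sum_const, Finset.card_range, nsmul_eq_mul]
    field_simp
    ring
  simp only [sampleCov, Matrix.smul_apply, Matrix.sum_apply, vecMulVec_apply, Pi.sub_apply,
    smul_eq_mul]
  rw [hsum]
  field_simp

end NetworkTraffic

end Deterministic

/-! ### Gaussian fourth moments and averages of squares. -/

section Gaussian

/-- The fourth moment is the fourth derivative at zero of the moment generating function `exp (v t²
/ 2)`, computed one derivative at a time. -/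
theorem integral_pow_four_gaussianReal (v : NNReal) :
    ∫ x, x ^ 4 ∂(gaussianReal 0 v) = 3 * (v : ℝ) ^ 2 := by
  have h0 : ∫ x, x ^ 4 ∂(gaussianReal 0 v)
      = iteratedDeriv 4 (mgf (fun x => x) (gaussianReal 0 v)) 0 := by
    rw [iteratedDeriv_mgf_zero (by simp)]
    rfl
  have hexp : ∀ t : ℝ, HasDerivAt (fun t : ℝ => Real.exp (v * t ^ 2 / 2))
      (v * t * Real.exp (v * t ^ 2 / 2)) t := by
    intro t
    have h := ((((hasDerivAt_id t).pow 2).const_mul (v : ℝ)).div_const 2).exp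
    refine h.congr_deriv ?_
    simp only [id_eq, Pi.pow_apply, Nat.cast_ofNat]
    ring
  have d1 : deriv (fun t : ℝ => Real.exp (v * t ^ 2 / 2))
      = fun t : ℝ => v * t * Real.exp (v * t ^ 2 / 2) := funext fun t => (hexp t).deriv
  have d2 : deriv (fun t : ℝ => v * t * Real.exp (v * t ^ 2 / 2))
      = fun t : ℝ => (v + v ^ 2 * t ^ 2) * Real.exp (v * t ^ 2 / 2) := by
    funext t
    refine ((((hasDerivAt_id t).const_mul (v : ℝ)).mul (hexp t)).congr_deriv ?_).deriv
    simp only [id_eq]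
    ring
  have d3 : deriv (fun t : ℝ => (v + v ^ 2 * t ^ 2) * Real.exp (v * t ^ 2 / 2))
      = fun t : ℝ => (3 * v ^ 2 * t + v ^ 3 * t ^ 3) * Real.exp (v * t ^ 2 / 2) := by
    funext t
    refine (((((((hasDerivAt_id t).pow 2).const_mul ((v : ℝ) ^ 2)).const_add (v : ℝ)).mul
      (hexp t))).congr_deriv ?_).deriv
    simp only [id_eq, Pi.pow_apply, Nat.cast_ofNat]
    ring
  have d4 : deriv (fun t : ℝ => (3 * v ^ 2 * t + v ^ 3 * t ^ 3) * Real.exp (v * t ^ 2 / 2)) 0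
      = 3 * (v : ℝ) ^ 2 := by
    have h := (((hasDerivAt_id (0 : ℝ)).const_mul (3 * (v : ℝ) ^ 2)).add
      (((hasDerivAt_id (0 : ℝ)).pow 3).const_mul ((v : ℝ) ^ 3))).mul (hexp 0)
    refine (h.congr_deriv ?_).deriv
    simp
  rw [h0, mgf_fun_id_gaussianReal]
  simp only [zero_mul, zero_add]
  rw [iteratedDeriv_succ, iteratedDeriv_succ, iteratedDeriv_succ, iteratedDeriv_one, d1, d2, d3,
    d4]

variable {Ω : Type*} [MeasurableSpace Ω] {P : Measure Ω}

theorem ProbabilityTheory.HasGaussianLaw.integral_pow_four {X : Ω → ℝ} (hX : HasGaussianLaw X P)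
    (h0 : ∫ ω, X ω ∂P = 0) : ∫ ω, X ω ^ 4 ∂P = 3 * (∫ ω, X ω ^ 2 ∂P) ^ 2 := by
  have hmap := hX.map_eq_gaussianReal
  rw [h0, variance_of_integral_eq_zero hX.aemeasurable h0] at hmap
  have h := integral_map (f := fun x : ℝ => x ^ 4) hX.aemeasurable (by fun_prop)
  rw [hmap, integral_pow_four_gaussianReal] at h
  rw [← h, Real.coe_toNNReal _ (integral_nonneg fun ω => sq_nonneg _)]

theorem ProbabilityTheory.HasGaussianLaw.memLp_mul {X Y : Ω → ℝ} (hX : HasGaussianLaw X P)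
    (hY : HasGaussianLaw Y P) : MemLp (fun ω => X ω * Y ω) 2 P := by
  have : ENNReal.HolderTriple 4 4 2 := ⟨by
    rw [← two_mul, ← div_eq_mul_inv, ENNReal.div_eq_inv_mul]
    rw [← ENNReal.toReal_eq_toReal_iff' (by simp [ENNReal.mul_eq_top]) (by simp)]
    norm_num⟩
  exact (hY.memLp (p := 4) (by simp)).mul (hX.memLp (p := 4) (by simp))

/-- The Isserlis formula for squares of two jointly Gaussian centred variables. -/
theorem integral_sq_mul_sq_of_hasGaussianLaw {X Y : Ω → ℝ}
    (h : HasGaussianLaw (fun ω => (X ω, Y ω)) P) (hX0 : ∫ ω, X ω ∂P = 0)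
    (hY0 : ∫ ω, Y ω ∂P = 0) :
    ∫ ω, X ω ^ 2 * Y ω ^ 2 ∂P
      = (∫ ω, X ω ^ 2 ∂P) * (∫ ω, Y ω ^ 2 ∂P) + 2 * (∫ ω, X ω * Y ω ∂P) ^ 2 := by
  have hX := h.fst
  have hY := h.snd
  have hXi := hX.integrable
  have hYi := hY.integrable
  have := hX.isProbabilityMeasure
  have hpow : ∀ {W : Ω → ℝ}, HasGaussianLaw W P → Integrable (fun ω => W ω ^ 4) P := fun {W} hW => by
    simpa [Even.pow_abs (show Even 4 by decide)] using
      (hW.memLp (p := 4) (by simp)).integrable_norm_pow (by norm_num)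
  have hsq : ∀ {W : Ω → ℝ}, HasGaussianLaw W P → Integrable (fun ω => W ω ^ 2) P := fun {W} hW =>
    hW.memLp_two.integrable_sq
  have hXY : Integrable (fun ω => 2 * (X ω * Y ω)) P :=
    ((hX.memLp_mul hY).integrable one_le_two).const_mul 2
  have hXY2 : Integrable (fun ω => 12 * (X ω ^ 2 * Y ω ^ 2)) P := by
    simpa [mul_pow] using (hX.memLp_mul hY).integrable_sq.const_mul 12
  have hX4 : Integrable (fun ω => 2 * X ω ^ 4) P := (hpow hX).const_mul 2
  have hY4 : Integrable (fun ω => 2 * Y ω ^ 4) P := (hpow hY).const_mul 2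
  have hp := h.fun_add.integral_pow_four (by rw [integral_add hXi hYi, hX0, hY0, add_zero])
  have hm := h.fun_sub.integral_pow_four (by rw [integral_sub hXi hYi, hX0, hY0, sub_zero])
  have e2p : ∫ ω, (X ω + Y ω) ^ 2 ∂P
      = ∫ ω, X ω ^ 2 ∂P + 2 * ∫ ω, X ω * Y ω ∂P + ∫ ω, Y ω ^ 2 ∂P := by
    have i1 : Integrable (fun ω => X ω ^ 2 + 2 * (X ω * Y ω)) P := (hsq hX).add hXY
    rw [← integral_const_mul, ← integral_add (hsq hX) hXY, ← integral_add i1 (hsq hY)]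
    exact integral_congr_ae (.of_forall fun ω => by ring)
  have e2m : ∫ ω, (X ω - Y ω) ^ 2 ∂P
      = ∫ ω, X ω ^ 2 ∂P - 2 * ∫ ω, X ω * Y ω ∂P + ∫ ω, Y ω ^ 2 ∂P := by
    have i1 : Integrable (fun ω => X ω ^ 2 - 2 * (X ω * Y ω)) P := (hsq hX).sub hXY
    rw [← integral_const_mul, ← integral_sub (hsq hX) hXY, ← integral_add i1 (hsq hY)]
    exact integral_congr_ae (.of_forall fun ω => by ring)
  -- The odd mixed terms cancel in the sum, leaving `X² Y²` as the only unknown: `X + Y` and `X - Y`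
  -- are Gaussian, so their fourth moments follow from second moments.
  have e4 : ∫ ω, (X ω + Y ω) ^ 4 ∂P + ∫ ω, (X ω - Y ω) ^ 4 ∂P
      = 2 * ∫ ω, X ω ^ 4 ∂P + 12 * ∫ ω, X ω ^ 2 * Y ω ^ 2 ∂P + 2 * ∫ ω, Y ω ^ 4 ∂P := by
    have i1 : Integrable (fun ω => 2 * X ω ^ 4 + 12 * (X ω ^ 2 * Y ω ^ 2)) P := hX4.add hXY2
    rw [← integral_add (hpow h.fun_add) (hpow h.fun_sub), ← integral_const_mul,
      ← integral_const_mul, ← integral_const_mul, ← integral_add hX4 hXY2, ← integral_add i1 hY4]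
    exact integral_congr_ae (.of_forall fun ω => by ring)
  rw [hp, hm, e2p, e2m, hX.integral_pow_four hX0, hY.integral_pow_four hY0] at e4
  linarith

variable {T : Ω → Ω}

theorem integral_comp_of_measurePreserving (hT : MeasurePreserving T P P) {g : Ω → ℝ}
    (hg : AEStronglyMeasurable g P) : ∫ ω, g (T ω) ∂P = ∫ ω, g ω ∂P := by
  have := integral_map (μ := P) (f := g) hT.measurable.aemeasurable (by rwa [hT.map_eq])
  rw [← this, hT.map_eq]

/-- The averages of the square of a Gaussian stationary sequence with vanishing autocorrelations
converge to the variance. -/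
theorem ae_tendsto_birkhoffAverage_sq (hT : MeasurePreserving T P P) {g : Ω → ℝ}
    (hgm : Measurable g) (hg : ∀ n, HasGaussianLaw (fun ω => (g ω, g (T^[n] ω))) P)
    (h0 : ∫ ω, g ω ∂P = 0) (h : Tendsto (fun n => ∫ ω, g ω * g (T^[n] ω) ∂P) atTop (𝓝 0)) :
    ∀ᵐ ω ∂P, Tendsto (fun n => birkhoffAverage ℝ T (fun ω => g ω ^ 2) n ω) atTop
      (𝓝 (∫ ω, g ω ^ 2 ∂P)) := by
  have hP := (hg 0).isProbabilityMeasure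
  have hg1 : HasGaussianLaw g P := (hg 0).fst
  set V := ∫ ω, g ω ^ 2 ∂P with hV
  have hf2 : MemLp (fun ω => g ω ^ 2) 2 P := by simpa only [sq] using hg1.memLp_mul hg1
  have hfm : Measurable fun ω => g ω ^ 2 - V := (hgm.pow_const 2).sub_const V
  have hf : MemLp (fun ω => g ω ^ 2 - V) 2 P := hf2.sub (memLp_const V)
  have hcorr : ∀ n, ∫ ω, (g ω ^ 2 - V) * (g (T^[n] ω) ^ 2 - V) ∂P
      = 2 * (∫ ω, g ω * g (T^[n] ω) ∂P) ^ 2 := by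
    intro n
    have hTn := hT.iterate n
    have hn0 : ∫ ω, g (T^[n] ω) ∂P = 0 := by
      rw [integral_comp_of_measurePreserving hTn hgm.aestronglyMeasurable, h0]
    have hn2 : ∫ ω, g (T^[n] ω) ^ 2 ∂P = V :=
      integral_comp_of_measurePreserving hTn (hgm.pow_const 2).aestronglyMeasurable
    have hI := integral_sq_mul_sq_of_hasGaussianLaw (hg n) h0 hn0
    rw [hn2, ← hV] at hI
    have i1 : Integrable (fun ω => g ω ^ 2) P := hf2.integrable one_le_two
    have i2 : Integrable (fun ω => g (T^[n] ω) ^ 2) P := hTn.integrable_comp_of_integrable i1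
    have i3 : Integrable (fun ω => g ω ^ 2 * g (T^[n] ω) ^ 2) P :=
      hf2.integrable_mul (hf2.comp_measurePreserving hTn)
    have e : ∀ ω, (g ω ^ 2 - V) * (g (T^[n] ω) ^ 2 - V)
        = g ω ^ 2 * g (T^[n] ω) ^ 2 - V * g ω ^ 2 - V * g (T^[n] ω) ^ 2 + V ^ 2 := fun ω => by ring
    simp_rw [e]
    have i4 : Integrable (fun ω => g ω ^ 2 * g (T^[n] ω) ^ 2 - V * g ω ^ 2) P :=
      i3.sub (i1.const_mul V)
    have i5 : Integrable
        (fun ω => g ω ^ 2 * g (T^[n] ω) ^ 2 - V * g ω ^ 2 - V * g (T^[n] ω) ^ 2) P :=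
      i4.sub (i2.const_mul V)
    rw [integral_add i5 (integrable_const _), integral_sub i4 (i2.const_mul V),
      integral_sub i3 (i1.const_mul V), integral_const_mul, integral_const_mul, hI, hn2, ← hV,
      integral_const]
    simp
    ring
  have hlim : Tendsto (fun n => ∫ ω, (g ω ^ 2 - V) * (g (T^[n] ω) ^ 2 - V) ∂P) atTop (𝓝 0) := by
    simp_rw [hcorr]
    simpa using (h.pow 2).const_mul 2
  filter_upwards [ae_tendsto_birkhoffAverage_zero hT hfm hf hlim] with ω hω
  have h1 := hω.add_const V
  rw [zero_add] at h1
  refine h1.congr' ?_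
  filter_upwards [eventually_ne_atTop 0] with n hn
  have hn' : (n : ℝ) ≠ 0 := by exact_mod_cast hn
  simp only [birkhoffAverage, birkhoffSum, Finset.sum_sub_distrib, Finset.sum_const,
    Finset.card_range, nsmul_eq_mul, smul_eq_mul]
  field_simp
  ring

section Vector

variable {ι : Type*} [Fintype ι] {u : ι → Ω → ℝ}

theorem hasGaussianLaw_linearCombination_iterate
    (hG : IsGaussianProcess (fun (q : ℕ × ι) ω => u q.2 (T^[q.1] ω)) P) (c : ι → ℝ) (n : ℕ) :
    HasGaussianLaw (fun ω => (∑ i, c i * u i ω, ∑ i, c i * u i (T^[n] ω))) P := by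
  classical
  have h : IsGaussianProcess (fun (n : ℕ) ω => ∑ i, c i * u i (T^[n] ω)) P := by
    refine hG.of_isGaussianProcess fun n => ?_
    refine ⟨Finset.univ.image fun i => (n, i), ∑ i, c i • ContinuousLinearMap.proj
      (⟨(n, i), Finset.mem_image_of_mem _ (Finset.mem_univ i)⟩ :
        (Finset.univ.image fun i => (n, i) : Finset (ℕ × ι))), fun ω => ?_⟩
    simp
  exact h.hasGaussianLaw_prodMk (s := 0) (t := n)

/-- Nothing is assumed about `u i` against `u j ∘ T^[n]` for `i ≠ j`. Weak convergence of each `u i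
∘ T^[n]` to zero, tested against the whole linear combination, covers these cross terms. -/
theorem tendsto_integral_linearCombination_mul_iterate (hT : MeasurePreserving T P P)
    (hu : ∀ i, MemLp (u i) 2 P)
    (h : ∀ i, Tendsto (fun n => ∫ ω, u i ω * u i (T^[n] ω) ∂P) atTop (𝓝 0)) (c : ι → ℝ) :
    Tendsto (fun n => ∫ ω, (∑ i, c i * u i ω) * (∑ i, c i * u i (T^[n] ω)) ∂P) atTop (𝓝 0) := by
  have hφ : MemLp (fun ω => ∑ i, c i * u i ω) 2 P :=
    memLp_finsetSum _ fun i _ => (hu i).const_mul (c i)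
  have e : ∀ n, ∫ ω, (∑ i, c i * u i ω) * (∑ i, c i * u i (T^[n] ω)) ∂P
      = ∑ i, c i * ∫ ω, (∑ i, c i * u i ω) * u i (T^[n] ω) ∂P := by
    intro n
    simp_rw [← integral_const_mul]
    rw [← integral_finsetSum]
    · refine integral_congr_ae (.of_forall fun ω => ?_)
      beta_reduce
      generalize ∑ i, c i * u i ω = S
      rw [Finset.mul_sum]
      exact Finset.sum_congr rfl fun i _ => mul_left_comm _ _ _
    · intro i _
      exact (hφ.integrable_mul ((hu i).comp_measurePreserving (hT.iterate n))).const_mul _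
  simp_rw [e]
  rw [show (0 : ℝ) = ∑ i : ι, c i * 0 by simp]
  exact tendsto_finsetSum _ fun i _ =>
    (tendsto_integral_mul_comp_iterate hT (hu i) hφ (h i)).const_mul (c i)

/-- The averages of a linear combination of centred jointly Gaussian stationary sequences with
vanishing autocorrelations, and of its square, converge to the expectations. -/
theorem ae_tendsto_birkhoffAverage_linearCombination (hT : MeasurePreserving T P P)
    (hum : ∀ i, Measurable (u i))
    (hG : IsGaussianProcess (fun (q : ℕ × ι) ω => u q.2 (T^[q.1] ω)) P)
    (h0 : ∀ i, ∫ ω, u i ω ∂P = 0)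
    (h : ∀ i, Tendsto (fun n => ∫ ω, u i ω * u i (T^[n] ω) ∂P) atTop (𝓝 0)) (c : ι → ℝ) :
    ∀ᵐ ω ∂P,
      Tendsto (fun n => birkhoffAverage ℝ T (fun ω => ∑ i, c i * u i ω) n ω) atTop (𝓝 0) ∧
      Tendsto (fun n => birkhoffAverage ℝ T (fun ω => (∑ i, c i * u i ω) ^ 2) n ω) atTop
        (𝓝 (∫ ω, (∑ i, c i * u i ω) ^ 2 ∂P)) := by
  have hP := hG.isProbabilityMeasure
  have hu : ∀ i, HasGaussianLaw (u i) P := fun i => hG.hasGaussianLaw_eval (0, i)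
  have hUm : Measurable fun ω => ∑ i, c i * u i ω :=
    Finset.measurable_fun_sum _ fun i _ => (hum i).const_mul (c i)
  have hU := hasGaussianLaw_linearCombination_iterate hG c
  have hcorr := tendsto_integral_linearCombination_mul_iterate hT (fun i => (hu i).memLp_two) h c
  have hU0 : ∫ ω, ∑ i, c i * u i ω ∂P = 0 := by
    rw [integral_finsetSum _ fun i _ => (hu i).integrable.const_mul (c i)]
    simp [integral_const_mul, h0]
  exact (ae_tendsto_birkhoffAverage_zero hT hUm (hU 0).fst.memLp_two hcorr).and
    (ae_tendsto_birkhoffAverage_sq hT hUm hU hU0 hcorr)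

end Vector

end Gaussian

/-! ### From the traffic process to the shift on path space. -/

section Model

variable {Ω : Type*} [MeasurableSpace Ω] {P : Measure Ω} {J : ℕ}

/-- The backward time shift on trajectories. -/
def backShift {E : Type*} (x : ℤ → E) (t : ℤ) : E := x (t + -1)

theorem iterate_backShift {E : Type*} (n : ℕ) (x : ℤ → E) (t : ℤ) :
    (backShift^[n] x) t = x (t - n) := by
  induction n generalizing x with
  | zero => simp
  | succ n ih =>
    rw [Function.iterate_succ_apply, ih, backShift]
    congr 1
    push_cast
    ring

theorem measurable_backShift {E : Type*} [MeasurableSpace E] :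
    Measurable (backShift : (ℤ → E) → ℤ → E) :=
  measurable_pi_lambda _ fun t => measurable_pi_apply (t + -1)

theorem NetworkTraffic.IsStrictlyStationary.measurePreserving_backShift {E : Type*}
    [MeasurableSpace E] {X : ℤ → Ω → E} (hX : NetworkTraffic.IsStrictlyStationary X P) :
    MeasurePreserving backShift (P.map fun ω t => X t ω) (P.map fun ω t => X t ω) := by
  refine ⟨measurable_backShift, ?_⟩
  rw [AEMeasurable.map_map_of_aemeasurable measurable_backShift.aemeasurable
    (hX 0).aemeasurable_snd]
  exact (hX (-1)).map_eq

/-- Transfers Gaussianity from `Ω`, which carries no shift, to the law on trajectories, where the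
ergodic theorem is applied. -/
theorem isGaussianProcess_map {ι S : Type*} [MeasurableSpace S] {f : Ω → S}
    (hf : AEMeasurable f P) {W : ι → S → ℝ} (hW : ∀ i, Measurable (W i))
    (h : IsGaussianProcess (fun i ω => W i (f ω)) P) : IsGaussianProcess W (P.map f) where
  hasGaussianLaw I := by
    have hm : Measurable fun x => I.restrict fun i => W i x :=
      measurable_pi_lambda _ fun i => hW i
    refine ⟨?_⟩
    rw [AEMeasurable.map_map_of_aemeasurable hm.aemeasurable hf]
    exact (h.hasGaussianLaw I).isGaussian_map

variable {Z : ℤ → Ω → Fin J → ℝ}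

section StandardNormal

variable {z : Ω → Fin J → ℝ}

theorem hasLaw_coord_of_standard
    (hz : HasLaw z (Measure.pi (fun _ : Fin J => gaussianReal 0 1)) P) (j : Fin J) :
    HasLaw (fun ω => z ω j) (gaussianReal 0 1) P :=
  HasLaw.comp (measurePreserving_eval (fun _ : Fin J => gaussianReal 0 1) j).hasLaw hz

theorem integral_sq_linearCombination_of_standard [IsProbabilityMeasure P]
    (hz : HasLaw z (Measure.pi (fun _ : Fin J => gaussianReal 0 1)) P) (d : Fin J → ℝ) :
    ∫ ω, (∑ j, d j * z ω j) ^ 2 ∂P = ∑ j, d j ^ 2 := by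
  have hj := hasLaw_coord_of_standard hz
  have hL : ∀ j, MemLp (fun ω => z ω j) 2 P := fun j => ((hj j).hasGaussianLaw).memLp_two
  have h0 : ∀ j, ∫ ω, z ω j ∂P = 0 := fun j => by
    rw [(hj j).integral_eq]; exact integral_id_gaussianReal
  have hind : iIndepFun (fun j ω => z ω j) P := by
    rw [iIndepFun_iff_map_fun_eq_pi_map fun j => (hj j).aemeasurable]
    simp_rw [(hj _).map_eq]
    exact hz.map_eq
  have hsum0 : ∫ ω, ∑ j, d j * z ω j ∂P = 0 := by
    rw [integral_finsetSum _ fun j _ => ((hL j).integrable one_le_two).const_mul (d j)]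
    simp [integral_const_mul, h0]
  have hm : AEMeasurable (fun ω => ∑ j, d j * z ω j) P :=
    Finset.aemeasurable_fun_sum _ fun j _ => (hj j).aemeasurable.const_mul (d j)
  rw [← variance_of_integral_eq_zero hm hsum0,
    variance_fun_sum fun j => (hL j).const_mul (d j)]
  refine Finset.sum_congr rfl fun i _ => ?_
  rw [Finset.sum_eq_single i]
  · rw [covariance_self ((hj i).aemeasurable.const_mul _), variance_const_mul, (hj i).variance_eq]
    simp
  · intro j _ hji
    rw [covariance_const_mul_left, covariance_const_mul_right,
      (hind.indepFun hji.symm).covariance_eq_zero (hL i) (hL j)]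
    simp
  · simp

end StandardNormal

variable {X : ℤ → Ω → Fin J → ℝ} {a s : Fin J → ℝ} {ρ : ℕ → ℝ}

/-- Covariance and the product of standard deviations both scale by `r ^ 2`, so neither the size nor
the sign of `r` matters. -/
theorem corr_affine_standard [IsProbabilityMeasure P] {U V : Ω → ℝ}
    (hU : HasLaw U (gaussianReal 0 1) P) (hV : HasLaw V (gaussianReal 0 1) P) (b : ℝ) {r : ℝ}
    (hr : r ≠ 0) :
    NetworkTraffic.corr (fun ω => b + r * U ω) (fun ω => b + r * V ω) P = ∫ ω, U ω * V ω ∂P := by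
  have hU2 := hU.hasGaussianLaw.memLp_two
  have hV2 := hV.hasGaussianLaw.memLp_two
  have hUi := (hU2.integrable one_le_two).const_mul r
  have hVi := (hV2.integrable one_le_two).const_mul r
  have hvar : ∀ {W : Ω → ℝ}, HasLaw W (gaussianReal 0 1) P →
      Var[fun ω => b + r * W ω; P] = r ^ 2 := fun {W} hW => by
    rw [variance_const_add (hW.aemeasurable.const_mul r).aestronglyMeasurable, variance_const_mul,
      hW.variance_eq]
    simp
  rw [NetworkTraffic.corr, hvar hU, hvar hV, Real.mul_self_sqrt (sq_nonneg r),
    covariance_const_add_left hUi, covariance_const_add_right hVi, covariance_const_mul_left,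
    covariance_const_mul_right, covariance_eq_sub hU2 hV2, hU.integral_eq, hV.integral_eq]
  simp only [integral_id_gaussianReal, Pi.mul_apply]
  field_simp
  ring

/-- Averages over a growing window into the past of the linear combinations of the coordinates of
a stationary Gaussian process with vanishing autocorrelations, and of their squares. -/
theorem ae_tendsto_average_linearCombination [IsProbabilityMeasure P]
    (hZ : IsGaussianProcess (fun (q : ℤ × Fin J) (ω : Ω) => Z q.1 ω q.2) P)
    (hZ_std : ∀ t : ℤ, HasLaw (Z t) (Measure.pi (fun _ : Fin J => gaussianReal 0 1)) P)
    (hX : ∀ t ω j, X t ω j = a j + s j * Z t ω j) (hs : ∀ j, s j ≠ 0)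
    (hX_stat : NetworkTraffic.IsStrictlyStationary X P)
    (hX_corr : ∀ (j : Fin J) (t : ℤ) (i : ℕ), 1 ≤ i →
      NetworkTraffic.corr (fun ω => X t ω j) (fun ω => X (t + i) ω j) P = ρ i)
    (hρ : Tendsto ρ atTop (𝓝 0)) (t₀ : ℤ) (c : Fin J → ℝ) :
    ∀ᵐ ω ∂P,
      Tendsto (fun m : ℕ => (m : ℝ)⁻¹ *
        ∑ k ∈ Finset.range m, ∑ j, c j * (X (t₀ - k) ω j - a j)) atTop (𝓝 0) ∧
      Tendsto (fun m : ℕ => (m : ℝ)⁻¹ *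
        ∑ k ∈ Finset.range m, (∑ j, c j * (X (t₀ - k) ω j - a j)) ^ 2) atTop
        (𝓝 (∑ j, (c j * s j) ^ 2)) := by
  set μ := P.map fun ω t => X t ω
  have htraj : AEMeasurable (fun ω t => X t ω) P := (hX_stat 0).aemeasurable_snd
  have hT : MeasurePreserving backShift μ μ := hX_stat.measurePreserving_backShift
  let u : Fin J → (ℤ → Fin J → ℝ) → ℝ := fun j x => x t₀ j - a j
  have hum : ∀ j, Measurable (u j) := fun j =>
    ((measurable_pi_apply j).comp
      (measurable_pi_apply (X := fun _ : ℤ => Fin J → ℝ) t₀)).sub_const (a j)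
  have hu : ∀ (n : ℕ) j ω, u j (backShift^[n] fun t => X t ω) = s j * Z (t₀ - n) ω j := by
    intro n j ω
    simp only [u, iterate_backShift, hX, add_sub_cancel_left]
  have hu0 : ∀ j ω, u j (fun t => X t ω) = s j * Z t₀ ω j := fun j ω => by
    simpa using hu 0 j ω
  have hcoord := fun t => hasLaw_coord_of_standard (hZ_std t)
  have hmap : ∀ {f : (ℤ → Fin J → ℝ) → ℝ}, Measurable f →
      ∫ x, f x ∂μ = ∫ ω, f (fun t => X t ω) ∂P := fun {f} hf =>
    integral_map htraj hf.aestronglyMeasurable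
  have hG : IsGaussianProcess (fun (q : ℕ × Fin J) x => u q.2 (backShift^[q.1] x)) μ := by
    refine isGaussianProcess_map htraj
      (fun q => (hum q.2).comp (measurable_backShift.iterate q.1)) ?_
    simp_rw [hu]
    exact (hZ.comp_right fun q : ℕ × Fin J => (t₀ - q.1, q.2)).smul fun q => s q.2
  have h0 : ∀ j, ∫ x, u j x ∂μ = 0 := by
    intro j
    rw [hmap (hum j)]
    simp_rw [hu0]
    rw [integral_const_mul, (hcoord t₀ j).integral_eq]
    simp
  have hcov : ∀ j, Tendsto (fun n => ∫ x, u j x * u j (backShift^[n] x) ∂μ) atTop (𝓝 0) := by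
    intro j
    have hlim : Tendsto (fun n => s j ^ 2 * ρ n) atTop (𝓝 0) := by
      simpa using hρ.const_mul (s j ^ 2)
    refine hlim.congr' ?_
    filter_upwards [eventually_ge_atTop 1] with n hn
    -- Starting at `t₀ - n` makes `t₀` the later time, matching the backward shift.
    have h1 := hX_corr j (t₀ - n) n hn
    simp_rw [hX] at h1
    rw [corr_affine_standard (hcoord _ j) (hcoord _ j) (a j) (hs j), sub_add_cancel] at h1
    have hm : Measurable fun x => u j x * u j (backShift^[n] x) :=
      (hum j).mul ((hum j).comp (measurable_backShift.iterate n))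
    rw [hmap hm, ← h1, ← integral_const_mul]
    refine integral_congr_ae (.of_forall fun ω => ?_)
    simp only [hu0, hu]
    ring
  have hvar : ∫ x, (∑ j, c j * u j x) ^ 2 ∂μ = ∑ j, (c j * s j) ^ 2 := by
    rw [hmap ((Finset.measurable_fun_sum _ fun j _ => (hum j).const_mul (c j)).pow_const 2)]
    simp_rw [hu0, ← mul_assoc]
    exact integral_sq_linearCombination_of_standard (hZ_std t₀) fun j => c j * s j
  have key := ae_of_ae_map htraj
    (ae_tendsto_birkhoffAverage_linearCombination hT hum hG h0 hcov c)
  rw [hvar] at key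
  filter_upwards [key] with ω hω
  simpa only [birkhoffAverage, birkhoffSum, smul_eq_mul, u, iterate_backShift] using hω

end Model

theorem proposition3 {Ω : Type*} [MeasurableSpace Ω] (P : Measure Ω) [IsProbabilityMeasure P]
    {L J p : ℕ}
    (A : Matrix (Fin L) (Fin J) ℝ) (O : Finset (Fin L)) (hO : O.Nonempty)
    (F : Matrix (Fin J) (Fin p) ℝ) (β : Fin p → ℝ) (γ σ : ℝ) (hσ : 0 < σ)
    (Z : ℤ → Ω → Fin J → ℝ) (ρ : ℕ → ℝ)
    -- `Z` is a Gaussian process and `Z(t)` is standard normal for every `t`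
    (hZ : IsGaussianProcess (fun (q : ℤ × Fin J) (ω : Ω) => Z q.1 ω q.2) P)
    (hZ_std : ∀ t : ℤ, HasLaw (Z t) (Measure.pi (fun _ : Fin J => gaussianReal 0 1)) P)
    -- the flow-level traffic is stationary, with the same temporal correlation on all routes
    (hX_stat : NetworkTraffic.IsStrictlyStationary (NetworkTraffic.flowTraffic F β γ σ Z) P)
    (hX_corr : ∀ (j : Fin J) (t : ℤ) (i : ℕ), 1 ≤ i →
      NetworkTraffic.corr (fun ω => NetworkTraffic.flowTraffic F β γ σ Z t ω j)
        (fun ω => NetworkTraffic.flowTraffic F β γ σ Z (t + i) ω j) P = ρ i)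
    -- `A_o` has full row rank, `A_o F` has full column rank, `Fβ > 0` and `ρ(τ) → 0`
    (hAo : (NetworkTraffic.observedRouting A O).rank = O.card)
    (hAoF : (NetworkTraffic.observedRouting A O * F).rank = p)
    (hFβ : ∀ j : Fin J, 0 < (F *ᵥ β) j)
    (hρ : Tendsto ρ atTop (𝓝 0))
    (t₀ : ℤ) (k : ℕ) (hk : 1 ≤ k) :
    ∀ᵐ ω ∂P,
      (∀ᶠ m : ℕ in atTop,
        NetworkTraffic.SigmaSqHatWellDefined (NetworkTraffic.observedRouting A O) F γ k
          (NetworkTraffic.observedTraffic O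
            (NetworkTraffic.linkTraffic A (NetworkTraffic.flowTraffic F β γ σ Z)) ω) t₀ m) ∧
      Tendsto (fun m : ℕ =>
        NetworkTraffic.sigmaSqHat (NetworkTraffic.observedRouting A O) F γ k
          (NetworkTraffic.observedTraffic O
            (NetworkTraffic.linkTraffic A (NetworkTraffic.flowTraffic F β γ σ Z)) ω) t₀ m)
        atTop (𝓝 (σ ^ 2)) := by
  have : Nonempty O := hO.to_subtype
  have hAo' : Function.Injective (NetworkTraffic.observedRouting A O)ᵀ.mulVec :=
    mulVec_injective_of_rank (by rw [rank_transpose, hAo, Fintype.card_coe])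
  have hAoF' : Function.Injective (NetworkTraffic.observedRouting A O * F).mulVec :=
    mulVec_injective_of_rank (by rw [hAoF, Fintype.card_fin])
  set X := NetworkTraffic.flowTraffic F β γ σ Z with hXdef
  set s : Fin J → ℝ := fun j => σ * |(F *ᵥ β) j| ^ γ with hs
  have hX : ∀ t ω j, X t ω j = (F *ᵥ β) j + s j * Z t ω j := by
    intro t ω j
    simp [hXdef, hs, NetworkTraffic.flowTraffic, mulVec_diagonal, mul_assoc]
  have hs0 : ∀ j, s j ≠ 0 := fun j =>
    (mul_pos hσ (Real.rpow_pos_of_pos (abs_pos.2 (hFβ j).ne') _)).ne'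
  have havg := ae_tendsto_average_linearCombination hZ hZ_std hX hs0 hX_stat hX_corr hρ t₀
  have h1 : ∀ᵐ ω ∂P, ∀ l : O, _ := ae_all_iff.2 fun l => havg (A l)
  -- Sums of two rows supply the squares needed to polarize products of observed deviations.
  have h2 : ∀ᵐ ω ∂P, ∀ l l' : O, _ :=
    ae_all_iff.2 fun l => ae_all_iff.2 fun l' => havg (A l + A l')
  filter_upwards [h1, h2] with ω hω1 hω2
  have hy : ∀ t (l : O), NetworkTraffic.observedTraffic O (NetworkTraffic.linkTraffic A X) ω t l
      - ((NetworkTraffic.observedRouting A O * F) *ᵥ β) l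
      = ∑ j, A l j * (X t ω j - (F *ᵥ β) j) := by
    intro t l
    rw [← mulVec_mulVec]
    simp only [NetworkTraffic.observedTraffic, NetworkTraffic.linkTraffic,
      NetworkTraffic.observedRouting, mulVec, dotProduct, submatrix_apply, id_eq, mul_sub,
      Finset.sum_sub_distrib]
  have hmean : ∀ l : O, Tendsto (fun m : ℕ => (m : ℝ)⁻¹ * ∑ k ∈ Finset.range m,
      (NetworkTraffic.observedTraffic O (NetworkTraffic.linkTraffic A X) ω (t₀ - k) l
        - ((NetworkTraffic.observedRouting A O * F) *ᵥ β) l)) atTop (𝓝 0) := by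
    intro l
    simp_rw [hy]
    exact (hω1 l).1
  refine NetworkTraffic.sigmaSqHat_consistent hAo' hAoF' hFβ
    (NetworkTraffic.tendsto_windowMean hmean)
    (NetworkTraffic.tendsto_sampleCov hmean fun l l' => ?_) hk
  simp_rw [hy]
  -- Polarization: `x y = ((x + y)² - x² - y²) / 2`, for the averages and for their limits alike.
  have h3 := (((hω2 l l').2.sub (hω1 l).2).sub (hω1 l').2).const_mul (1 / 2)
  convert! h3 using 1
  · funext m
    rw [← mul_sub, ← mul_sub, ← Finset.sum_sub_distrib, ← Finset.sum_sub_distrib, mul_left_comm,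
      Finset.mul_sum (a := (1 / 2 : ℝ))]
    congr 1
    refine Finset.sum_congr rfl fun k _ => ?_
    simp only [Pi.add_apply, add_mul, Finset.sum_add_distrib]
    ring
  -- Polarization turns the limits into `∑ j, A l j * A l' j * s j ^ 2`, and `|x| ^ (2 * γ) = |x| ^
  -- γ * |x| ^ γ` identifies this with the entry of `σ ^ 2 • sigmaOO`.
  · congr 1
    rw [← Finset.sum_sub_distrib, ← Finset.sum_sub_distrib, Finset.mul_sum]
    rw [Matrix.smul_apply, NetworkTraffic.sigmaOO, Matrix.mul_apply, smul_eq_mul, Finset.mul_sum]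
    refine Finset.sum_congr rfl fun j _ => ?_
    rw [mul_diagonal, two_mul γ, Real.rpow_add (abs_pos.2 (hFβ j).ne')]
    simp only [NetworkTraffic.observedRouting, transpose_apply, submatrix_apply, id_eq,
      Pi.add_apply, hs]
    ring
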